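/- Let $(X,\mu)$ be a standard (Lebesgue) non-atomic probability space, that is, a standard Borel space with a non-atomic probability measure. Let $\psi(N)\to+0$, i.e. $(\psi(N))_{N\ge 1}$ is a sequence of real numbers which tends to $0$ and is positive for all sufficiently large $N$, and let $a\in(0,1)$. Then there exist a measurable set $A\subset X$ with $\mu(A)=a$ and an ergodic automorphism $T$ of $(X,\mu)$ (an invertible bimeasurable $\mu$-preserving transformation of $X$ that is ergodic) such that, for the indicator $f=\chi_A$ and its ergodic averages $f_N(T,x)=\frac1N\sum_{i=1}^{N}f(T^i x)$, for $\mu$-almost every $x\in X$ $$\limsup_{N\to\infty}\frac{|f_N(T,x)-\mu(A)|}{\psi(N)}=\infty .$$ -/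

import Mathlib

/-- The ergodic (time) average `f_N(T, x) = (1 / N) * ∑_{i = 1}^{N} f (T^i x)`. -/
noncomputable def ergodicAverage {X : Type*} (T : X → X) (f : X → ℝ) (N : ℕ) (x : X) : ℝ :=
  (1 / (N : ℝ)) * ∑ i ∈ Finset.Icc 1 N, f (T^[i] x)

/-!
The system is a rotation of the circle by an angle of infinite order which is extremely well
approximated by angles of finite order.

If `q • β = 0`, the average of an indicator function along the rotation by `β` over a multiple of
`q` steps is `c / q` with `c` an integer. If moreover `q * a` is not an integer, this average
differs from `a` at every point by at least a constant `δ > 0`, however many periods are taken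
(`exists_pos_forall_le_abs_ergodicAverage_sub`). Since `ψ` tends to `0`, a multiple `N` of `q` can be
chosen with `k * ψ N < δ`. With `N` fixed, the average over `N` steps along a rotation by `α` agrees
with that along `β` outside a set whose measure tends to `0` as `α` tends to `β`
(`tendsto_measure_ergodicAverage_ne`). Hence the angles for which the deviation exceeds `k * ψ N` at
some time `N ≥ k`, outside a set of measure at most `1 / (k + 1)`, contain a neighbourhood of every
such `β`. These `β` are dense, because of two consecutive integers `q` at most one makes `q * a` an
integer when `0 < a < 1`; so the Baire category theorem yields an angle of infinite order that works
for all `k` (`exists_slow_rotation`), and the rotation by it is ergodic. The set `A` enters only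
through its measure: on the circle it can be any measurable set of measure `a`.

A non-atomic standard probability space is isomorphic to the circle modulo null sets, by the
probability integral transform (`exists_measurePreserving_injOn_unitAddCircle`), and an ergodic
automorphism lifts along such an isomorphism to an everywhere defined one
(`exists_ergodic_semiconj_of_injOn`).
-/

open MeasureTheory Set Filter Topology ProbabilityTheory
open scoped symmDiff

/-! ### Non-atomic standard probability spaces and the circle -/

/-- The jump of the cumulative distribution function at `x` is the mass of `{x}`. -/
theorem continuous_cdf (ν : Measure ℝ) [IsProbabilityMeasure ν] [NullSingletonClass ν] :
    Continuous (cdf ν) := by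
  refine continuous_iff_continuousAt.2 fun x => ?_
  have hx : (cdf ν).measure {x} = 0 := by rw [measure_cdf]; simp
  rw [StieltjesFunction.measure_singleton, ENNReal.ofReal_eq_zero, sub_nonpos] at hx
  have hleft : Function.leftLim (cdf ν) x = cdf ν x :=
    le_antisymm ((monotone_cdf ν).leftLim_le le_rfl) hx
  have h1 : ContinuousWithinAt (cdf ν) (Iio x) x :=
    (monotone_cdf ν).continuousWithinAt_Iio_iff_leftLim_eq.2 hleft
  exact continuousAt_iff_continuous_left'_right'.2
    ⟨h1, ((cdf ν).right_continuous x).mono Ioi_subset_Ici_self⟩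

/-- The probability integral transform: a non-atomic law on `ℝ` is carried by its cumulative
distribution function to the uniform law on the unit interval. -/
theorem measurePreserving_cdf (ν : Measure ℝ) [IsProbabilityMeasure ν] [NullSingletonClass ν] :
    MeasurePreserving (cdf ν) ν (volume.restrict (Ioc 0 1)) := by
  have hc := continuous_cdf ν
  refine ⟨hc.measurable, ?_⟩
  have : IsProbabilityMeasure (ν.map (cdf ν)) :=
    Measure.isProbabilityMeasure_map hc.measurable.aemeasurable
  have hle : ∀ t : ℝ, 0 < t → t < 1 → ∃ x, cdf ν x = t := fun t h0 h1 => by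
    obtain ⟨u, hu⟩ := ((tendsto_cdf_atBot ν).eventually_lt_const h0).exists
    obtain ⟨v, hv⟩ := ((tendsto_cdf_atTop ν).eventually_const_lt h1).exists
    exact mem_range_of_exists_le_of_exists_ge hc ⟨u, hu.le⟩ ⟨v, hv.le⟩
  have hupper : ∀ t s : ℝ, t < s → 0 < s → s < 1 →
      ν (cdf ν ⁻¹' Iic t) ≤ ENNReal.ofReal s := fun t s hts h0 h1 => by
    obtain ⟨x, rfl⟩ := hle s h0 h1
    rw [ofReal_cdf]
    exact measure_mono fun y hy =>
      le_of_lt ((monotone_cdf ν).reflect_lt (lt_of_le_of_lt hy hts))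
  refine Measure.ext_of_Iic _ _ fun t => ?_
  rw [Measure.map_apply hc.measurable measurableSet_Iic,
    Measure.restrict_apply measurableSet_Iic, inter_comm, Ioc_inter_Iic, Real.volume_Ioc, sub_zero]
  rcases le_or_gt 1 t with h1 | h1
  · have : cdf ν ⁻¹' Iic t = univ := eq_univ_of_forall fun x => (cdf_le_one ν x).trans h1
    simp [this, h1]
  · rw [min_eq_right h1.le]
    refine le_antisymm ?_ ?_
    -- The set `{cdf ν ≤ t}` may exceed the half-line `Iic x` with `cdf ν x = t` by an interval on
    -- which `cdf ν` is constant, so the upper bound comes from levels `s > t`.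
    · have hlim : Tendsto ENNReal.ofReal (𝓝[>] (max t 0)) (𝓝 (ENNReal.ofReal (max t 0))) :=
        (ENNReal.continuous_ofReal.tendsto _).mono_left nhdsWithin_le_nhds
      have hmax : ENNReal.ofReal (max t 0) = ENNReal.ofReal t := by simp
      rw [← hmax]
      refine ge_of_tendsto hlim ?_
      filter_upwards [Ioo_mem_nhdsGT (max_lt h1 zero_lt_one)] with s hs
      exact hupper t s ((le_max_left _ _).trans_lt hs.1) ((le_max_right _ _).trans_lt hs.1) hs.2
    · rcases le_or_gt t 0 with h0 | h0
      · simp [ENNReal.ofReal_of_nonpos h0]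
      · obtain ⟨x, rfl⟩ := hle t h0 h1
        rw [ofReal_cdf]
        exact measure_mono fun y hy => monotone_cdf ν hy

/-- Every non-atomic standard probability space is isomorphic, modulo null sets, to the circle.
Composing a Borel embedding in `ℝ`, the cumulative distribution function of the image law and the
covering map loses injectivity only over the countably many values that the distribution function
takes more than once and over the base point `0` of the circle. -/
theorem exists_measurePreserving_injOn_unitAddCircle {X : Type*} [MeasurableSpace X]
    [StandardBorelSpace X] (μ : Measure X) [IsProbabilityMeasure μ] [NullSingletonClass μ] :
    ∃ (φ : X → UnitAddCircle) (s : Set X), MeasurePreserving φ μ volume ∧ MeasurableSet s ∧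
      μ sᶜ = 0 ∧ InjOn φ s := by
  have he : MeasurableEmbedding (embeddingReal X) := measurableEmbedding_embeddingReal X
  set ν : Measure ℝ := μ.map (embeddingReal X) with hν
  have : IsProbabilityMeasure ν := Measure.isProbabilityMeasure_map he.measurable.aemeasurable
  have : NullSingletonClass ν := ⟨fun x => by
    rw [hν, he.map_apply]
    exact (subsingleton_singleton.preimage he.injective).measure_zero μ⟩
  have hF : MeasurePreserving (cdf ν ∘ embeddingReal X) μ (volume.restrict (Ioc 0 1)) :=
    (measurePreserving_cdf ν).comp ⟨he.measurable, rfl⟩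
  set C : Set ℝ := {c | ∃ x y, x < y ∧ cdf ν x = c ∧ cdf ν y = c} with hC
  have hCc : C.Countable := (monotone_cdf ν).countable_setOfPred_two_preimages
  have hmeas : MeasurableSet (Ioo 0 1 \ C) := measurableSet_Ioo.diff hCc.measurableSet
  refine ⟨(↑) ∘ cdf ν ∘ embeddingReal X, (cdf ν ∘ embeddingReal X) ⁻¹' (Ioo 0 1 \ C),
    ?_, hF.measurable hmeas, ?_, ?_⟩
  · have h := UnitAddCircle.measurePreserving_mk 0
    rw [zero_add] at h
    exact h.comp hF
  · rw [← preimage_compl, hF.measure_preimage hmeas.compl.nullMeasurableSet,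
      restrict_Ioo_eq_restrict_Ioc.symm, Measure.restrict_apply hmeas.compl]
    exact measure_mono_null (fun t ht => by_contra fun hC' => ht.1 ⟨ht.2, hC'⟩)
      (hCc.measure_zero volume)
  · rintro x hx y hy hxy
    have hxy' : cdf ν (embeddingReal X x) = cdf ν (embeddingReal X y) := by
      refine (AddCircle.coe_eq_coe_iff_of_mem_Ico (p := (1 : ℝ)) (a := 0) ?_ ?_).1 hxy
      · rw [zero_add]; exact Ioo_subset_Ico_self hx.1
      · rw [zero_add]; exact Ioo_subset_Ico_self hy.1
    refine he.injective (le_antisymm (not_lt.1 fun h => hx.2 ?_) (not_lt.1 fun h => hx.2 ?_))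
    · exact ⟨_, _, h, hxy'.symm, rfl⟩
    · exact ⟨_, _, h, rfl, hxy'.symm⟩

/-! ### Lifting ergodic automorphisms -/

/-- An ergodic automorphism `S` lifts along an isomorphism modulo null sets `φ` to an everywhere
defined ergodic automorphism: conjugate by `φ` on the part of `s` lying over the points whose whole
`S`-orbit stays in `φ '' s`, and let the lift be the identity on the remaining null set. -/
theorem exists_ergodic_semiconj_of_injOn {X Y : Type*} [MeasurableSpace X] [StandardBorelSpace X]
    [MeasurableSpace Y] [StandardBorelSpace Y] {μ : Measure X} [NeZero μ] {ν : Measure Y}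
    {φ : X → Y} (hφ : MeasurePreserving φ μ ν) {s : Set X} (hs : MeasurableSet s) (hμs : μ sᶜ = 0)
    (hinj : InjOn φ s) (S : Y ≃ᵐ Y) (hS : Ergodic S ν) :
    ∃ T : X ≃ᵐ X, Ergodic T μ ∧ ∀ᵐ x ∂μ, ∀ n : ℕ, φ (T^[n] x) = S^[n] (φ x) := by
  classical
  have hS' : MeasurePreserving S.symm ν ν := hS.toMeasurePreserving.symm S
  set Y₀ : Set Y := φ '' s with hY₀
  have hY₀m : MeasurableSet Y₀ := hs.image_of_measurable_injOn hφ.measurable hinj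
  have hνY₀ : ∀ᵐ y ∂ν, y ∈ Y₀ := by
    rw [ae_iff]
    change ν Y₀ᶜ = 0
    rw [← hφ.measure_preimage hY₀m.compl.nullMeasurableSet]
    exact measure_mono_null (fun x hx hxs => hx (mem_image_of_mem φ hxs)) hμs
  set Y₁ : Set Y := {y | ∀ n : ℕ, S^[n] y ∈ Y₀ ∧ S.symm^[n] y ∈ Y₀} with hY₁
  have hY₁m : MeasurableSet Y₁ := by
    rw [hY₁, ofPred_forall]
    exact MeasurableSet.iInter fun n =>
      ((S.measurable.iterate n) hY₀m).inter ((S.symm.measurable.iterate n) hY₀m)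
  have hνY₁ : ∀ᵐ y ∂ν, y ∈ Y₁ := ae_all_iff.2 fun n =>
    ((hS.toMeasurePreserving.iterate n).quasiMeasurePreserving.ae hνY₀).and
      ((hS'.iterate n).quasiMeasurePreserving.ae hνY₀)
  have hfwd : ∀ y ∈ Y₁, S y ∈ Y₁ := by
    intro y hy n
    refine ⟨by simpa only [Function.iterate_succ_apply] using (hy (n + 1)).1, ?_⟩
    rcases n with _ | n
    · exact (hy 1).1
    · simpa only [Function.iterate_succ_apply, S.symm_apply_apply] using (hy n).2
  have hbwd : ∀ y ∈ Y₁, S.symm y ∈ Y₁ := by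
    intro y hy n
    refine ⟨?_, by simpa only [Function.iterate_succ_apply] using (hy (n + 1)).2⟩
    rcases n with _ | n
    · exact (hy 1).2
    · simpa only [Function.iterate_succ_apply, S.apply_symm_apply] using (hy n).1
  set X₁ : Set X := s ∩ φ ⁻¹' Y₁ with hX₁
  have hX₁m : MeasurableSet X₁ := hs.inter (hφ.measurable hY₁m)
  have hμX₁ : ∀ᵐ x ∂μ, x ∈ X₁ := by
    filter_upwards [hφ.quasiMeasurePreserving.ae hνY₁, compl_mem_ae_iff.2 hμs] with x h1 h2
    exact ⟨not_not.1 h2, h1⟩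
  have hinj₁ : InjOn φ X₁ := hinj.mono inter_subset_left
  obtain ⟨g, hgm, hg⟩ : ∃ g : Y → X, Measurable g ∧ ∀ x ∈ X₁, g (φ x) = x := by
    have := hX₁m.standardBorel
    have hj : MeasurableEmbedding (fun x : X₁ => φ x) :=
      (hφ.measurable.comp measurable_subtype_coe).measurableEmbedding
        (fun x y h => Subtype.ext (hinj₁ x.2 y.2 h))
    obtain ⟨x₀, -⟩ := hμX₁.exists
    obtain ⟨g, hgm, hg⟩ := hj.exists_measurable_extend measurable_subtype_coe fun _ => ⟨x₀⟩
    exact ⟨g, hgm, fun x hx => congr_fun hg ⟨x, hx⟩⟩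
  have hgX₁ : ∀ y ∈ Y₁, g y ∈ X₁ ∧ φ (g y) = y := by
    intro y hy
    obtain ⟨x, hx, rfl⟩ : y ∈ φ '' s := (hy 0).1
    have hx1 : x ∈ X₁ := ⟨hx, hy⟩
    rw [hg x hx1]
    exact ⟨hx1, rfl⟩
  -- The conjugate of `U` by `φ` on `X₁`, continued by the identity.
  let c : (Y → Y) → X → X := fun U x => if x ∈ X₁ then g (U (φ x)) else x
  have hcm : ∀ U : Y → Y, Measurable U → Measurable (c U) := fun U hU =>
    Measurable.ite hX₁m (hgm.comp (hU.comp hφ.measurable)) measurable_id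
  have hc_mem : ∀ U : Y → Y, ∀ x ∈ X₁, c U x = g (U (φ x)) := fun U x hx => if_pos hx
  have hc_inv : ∀ U V : Y → Y, (∀ y ∈ Y₁, U y ∈ Y₁) → (∀ y, V (U y) = y) →
      Function.LeftInverse (c V) (c U) := by
    intro U V hU hVU x
    by_cases hx : x ∈ X₁
    · obtain ⟨h1, h2⟩ := hgX₁ _ (hU _ hx.2)
      rw [hc_mem U x hx, hc_mem V _ h1, h2, hVU, hg x hx]
    · simp [c, hx]
  let T : X ≃ᵐ X :=
    { toFun := c S
      invFun := c S.symm
      left_inv := hc_inv S S.symm hfwd S.symm_apply_apply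
      right_inv := hc_inv S.symm S hbwd S.apply_symm_apply
      measurable_toFun := hcm S S.measurable
      measurable_invFun := hcm S.symm S.symm.measurable }
  have hT : ∀ x ∈ X₁, T x ∈ X₁ ∧ φ (T x) = S (φ x) := by
    intro x hx
    have h := hgX₁ _ (hfwd _ hx.2)
    rwa [← hc_mem S x hx] at h
  -- Modulo null sets, `B ↦ φ '' (B ∩ X₁)` is inverse to `φ ⁻¹'` and intertwines `T ⁻¹'` with
  -- `S ⁻¹'`, which reduces invariance of `μ` and ergodicity to the same facts about `S` and `ν`.
  have hD : ∀ B : Set X, MeasurableSet B → MeasurableSet (φ '' (B ∩ X₁)) := fun B hB =>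
    (hB.inter hX₁m).image_of_measurable_injOn hφ.measurable (hinj₁.mono inter_subset_right)
  have hDB : ∀ B : Set X, φ ⁻¹' (φ '' (B ∩ X₁)) =ᵐ[μ] B := by
    intro B
    filter_upwards [hμX₁] with x hx
    refine propext ⟨?_, fun h => ⟨x, ⟨h, hx⟩, rfl⟩⟩
    rintro ⟨z, hz, hzx⟩
    exact hinj₁ hz.2 hx hzx ▸ hz.1
  have hTB : ∀ B : Set X, T ⁻¹' B =ᵐ[μ] φ ⁻¹' (S ⁻¹' (φ '' (B ∩ X₁))) := by
    intro B
    filter_upwards [hμX₁] with x hx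
    obtain ⟨h1, h2⟩ := hT x hx
    refine propext (?_ : x ∈ T ⁻¹' B ↔ _)
    refine ⟨fun h => ⟨T x, ⟨h, h1⟩, h2⟩, ?_⟩
    rintro ⟨z, hz, hzx⟩
    rw [mem_preimage, ← hinj₁ hz.2 h1 (hzx.trans h2.symm)]
    exact hz.1
  have hTmp : MeasurePreserving T μ μ := by
    refine ⟨T.measurable, Measure.ext fun B hB => ?_⟩
    rw [Measure.map_apply T.measurable hB, measure_congr (hTB B),
      hφ.measure_preimage (S.measurable (hD B hB)).nullMeasurableSet,
      hS.measure_preimage (hD B hB).nullMeasurableSet,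
      ← hφ.measure_preimage (hD B hB).nullMeasurableSet, measure_congr (hDB B)]
  refine ⟨T, ⟨hTmp, ⟨fun B hB hTB' => ?_⟩⟩, ?_⟩
  · have hinv : S ⁻¹' (φ '' (B ∩ X₁)) = φ '' (B ∩ X₁) := by
      ext y
      constructor
      · rintro ⟨z, hz, hzy⟩
        have hy : y ∈ Y₁ := by
          have := hbwd _ (hz.2.2 : φ z ∈ Y₁)
          rwa [hzy, S.symm_apply_apply] at this
        obtain ⟨h1, h2⟩ := hgX₁ y hy
        obtain ⟨h3, h4⟩ := hT _ h1
        refine ⟨g y, ⟨?_, h1⟩, h2⟩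
        rw [← hTB', mem_preimage, hinj₁ h3 hz.2 (by rw [h4, h2, hzy])]
        exact hz.1
      · rintro ⟨z, hz, rfl⟩
        obtain ⟨h1, h2⟩ := hT z hz.2
        exact ⟨T z, ⟨by rw [← mem_preimage, hTB']; exact hz.1, h1⟩, h2⟩
    have h := hS.aeconst_set (hD B hB) hinv
    rw [eventuallyConst_set'] at h ⊢
    refine h.imp (fun h => ?_) fun h => ?_
    · exact (hDB B).symm.trans (hφ.quasiMeasurePreserving.preimage_ae_eq h)
    · exact (hDB B).symm.trans (hφ.quasiMeasurePreserving.preimage_ae_eq h)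
  · filter_upwards [hμX₁] with x hx n
    have : T^[n] x ∈ X₁ ∧ φ (T^[n] x) = S^[n] (φ x) := by
      induction n with
      | zero => exact ⟨hx, rfl⟩
      | succ n ih =>
        obtain ⟨h1, h2⟩ := hT _ ih.1
        rw [Function.iterate_succ_apply', Function.iterate_succ_apply', ← ih.2]
        exact ⟨h1, h2⟩
    exact this.2

/-! ### Slow convergence for rotations of the circle -/

theorem ergodicAverage_add_right (f : UnitAddCircle → ℝ) (α : UnitAddCircle) (N : ℕ)
    (x : UnitAddCircle) :
    ergodicAverage (· + α) f N x = (1 / (N : ℝ)) * ∑ i ∈ Finset.Icc 1 N, f (x + i • α) := by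
  simp only [ergodicAverage, add_right_iterate_apply]

theorem sum_Icc_mul_of_periodic {h : ℕ → ℝ} {q : ℕ} (hh : Function.Periodic h q) (M : ℕ) :
    ∑ i ∈ Finset.Icc 1 (M * q), h i = M * ∑ i ∈ Finset.Icc 1 q, h i := by
  have key : ∀ n, ∑ i ∈ Finset.Icc 1 n, h i = ∑ i ∈ Finset.range n, h (i + 1) := fun n => by
    rw [Finset.range_eq_Ico, Finset.sum_Ico_add' h 0 n 1, zero_add]; rfl
  simp only [key]
  induction M with
  | zero => simp
  | succ M ih =>
    rw [add_mul, one_mul, Finset.sum_range_add, ih]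
    have : ∀ x, h (M * q + x + 1) = h (x + 1) := fun x => by
      rw [show M * q + x + 1 = x + 1 + M * q by ring]
      exact hh.nat_mul M (x + 1)
    simp only [this]
    push_cast
    ring

/-- Along a rotation of period `q`, the averages of an indicator over multiples of `q` steps are
integer multiples of `1 / q`, so that they stay away from `a` uniformly in the point and in the
number of periods when `q * a` is not an integer. No relation between `a` and `A` is needed. -/
theorem exists_pos_forall_le_abs_ergodicAverage_sub (A : Set UnitAddCircle) {a : ℝ}
    {β : UnitAddCircle} {q : ℕ} (hq : 0 < q) (hβ : q • β = 0) (hqa : ∀ m : ℤ, (m : ℝ) ≠ q * a) :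
    ∃ δ > 0, ∀ M : ℕ, 0 < M → ∀ x,
      δ ≤ |ergodicAverage (· + β) (A.indicator fun _ => (1 : ℝ)) (M * q) x - a| := by
  have hq' : (0 : ℝ) < q := Nat.cast_pos.2 hq
  refine ⟨|q * a - round (q * a)| / q, div_pos (abs_pos.2 (sub_ne_zero.2 (hqa _).symm)) hq',
    fun M hM x => ?_⟩
  have hM' : (0 : ℝ) < M := Nat.cast_pos.2 hM
  obtain ⟨m, hm⟩ : ∃ m : ℤ,
      ∑ i ∈ Finset.Icc 1 q, A.indicator (fun _ => (1 : ℝ)) (x + i • β) = m := by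
    classical
    refine ⟨∑ i ∈ Finset.Icc 1 q, if x + i • β ∈ A then 1 else 0, ?_⟩
    push_cast
    simp only [indicator_apply]
  have hper : Function.Periodic (fun i : ℕ => A.indicator (fun _ => (1 : ℝ)) (x + i • β)) q :=
    fun i => by simp only [add_smul, hβ, add_zero]
  rw [ergodicAverage_add_right, sum_Icc_mul_of_periodic hper, hm]
  have : 1 / ((M * q : ℕ) : ℝ) * (M * m) - a = -((q * a - m) / q) := by
    push_cast
    field_simp
    ring
  rw [this, abs_neg, abs_div, abs_of_pos hq']
  exact div_le_div_of_nonneg_right (round_le (q * a) m) hq'.le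

/-- Translates of a measurable set depend continuously, in measure, on the translation. -/
theorem tendsto_measure_symmDiff_preimage_add_nsmul {G : Type*} [AddCommGroup G]
    [TopologicalSpace G] [IsTopologicalAddGroup G] [MeasurableSpace G] [BorelSpace G]
    (μ : Measure G) [μ.InnerRegularCompactLTTop] [IsFiniteMeasure μ] [μ.IsAddRightInvariant]
    {A : Set G} (hA : MeasurableSet A) (i : ℕ) (β : G) :
    Tendsto (fun α : G => μ (((· + i • α) ⁻¹' A) ∆ ((· + i • β) ⁻¹' A))) (𝓝 β) (𝓝 0) := by
  let F : C(G, C(G, G)) := ContinuousMap.curry ⟨fun p => p.2 + i • p.1, by fun_prop⟩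
  have hF : ∀ α, MeasurePreserving (F α) μ μ := fun α => measurePreserving_add_right μ (i • α)
  have h := tendsto_measure_symmDiff_preimage_nhds_zero (μ := μ) (ν := μ) (s := A)
    (F.continuous.tendsto β) (.of_forall hF) (hF β) hA.nullMeasurableSet (measure_ne_top _ _)
  exact h

/-- Over a fixed number of steps, the average along a rotation near `β` agrees with the average
along `β` outside a set of small measure. -/
theorem tendsto_measure_ergodicAverage_ne {A : Set UnitAddCircle} (hA : MeasurableSet A)
    (N : ℕ) (β : UnitAddCircle) :
    Tendsto (fun α : UnitAddCircle => volume
      {x | ergodicAverage (· + α) (A.indicator fun _ => (1 : ℝ)) N x ≠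
        ergodicAverage (· + β) (A.indicator fun _ => (1 : ℝ)) N x}) (𝓝 β) (𝓝 0) := by
  have hsum := tendsto_finsetSum (Finset.Icc 1 N) fun i _ =>
    tendsto_measure_symmDiff_preimage_add_nsmul (volume : Measure UnitAddCircle) hA i β
  rw [Finset.sum_const_zero] at hsum
  refine tendsto_of_tendsto_of_tendsto_of_le_of_le tendsto_const_nhds hsum
    (fun _ => zero_le) fun α => ?_
  refine (measure_mono fun x hx => ?_).trans (measure_biUnion_finset_le _ _)
  by_contra hx'
  refine hx ?_
  rw [ergodicAverage_add_right, ergodicAverage_add_right]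
  congr 1
  refine Finset.sum_congr rfl fun i hi => ?_
  have : ¬ x ∈ ((· + i • α) ⁻¹' A) ∆ ((· + i • β) ⁻¹' A) := fun h =>
    hx' (mem_biUnion (Finset.mem_coe.2 hi) h)
  simp only [mem_symmDiff, mem_preimage] at this
  by_cases h1 : x + i • α ∈ A <;> by_cases h2 : x + i • β ∈ A <;> simp_all

/-- Of any two consecutive denominators `q`, at least one makes `q * a` a non-integer. -/
theorem dense_setOf_div_mul_ne_intCast {a : ℝ} (ha : ∀ m : ℤ, (m : ℝ) ≠ a) :
    Dense {r : ℝ | ∃ (q : ℕ) (p : ℤ), 0 < q ∧ r = p / q ∧ ∀ m : ℤ, (m : ℝ) ≠ q * a} := by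
  refine Metric.dense_iff.2 fun x ε hε => ?_
  obtain ⟨n, hn⟩ := exists_nat_one_div_lt hε
  obtain ⟨q, hnq, hq⟩ : ∃ q : ℕ, n + 1 ≤ q ∧ ∀ m : ℤ, (m : ℝ) ≠ q * a := by
    by_contra! h
    obtain ⟨m₁, h₁⟩ := h (n + 1) le_rfl
    obtain ⟨m₂, h₂⟩ := h (n + 2) (by omega)
    refine ha (m₂ - m₁) ?_
    push_cast at *
    linarith
  have hq' : (0 : ℝ) < q := Nat.cast_pos.2 (by omega)
  refine ⟨⌊x * q⌋ / q, ?_, q, ⌊x * q⌋, by omega, rfl, hq⟩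
  have h1 : (⌊x * q⌋ : ℝ) / q - x = -(Int.fract (x * q) / q) := by
    rw [Int.fract]; field_simp; ring
  have hnq' : (n : ℝ) + 1 ≤ q := by exact_mod_cast hnq
  rw [Metric.mem_ball, Real.dist_eq, h1, abs_neg,
    abs_of_nonneg (div_nonneg (Int.fract_nonneg _) hq'.le)]
  calc Int.fract (x * q) / q ≤ 1 / q := by gcongr; exact (Int.fract_lt_one _).le
    _ ≤ 1 / ((n : ℝ) + 1) := by gcongr
    _ < ε := hn

theorem addOrderOf_coe_eq_zero_of_irrational {α : ℝ} (hα : Irrational α) :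
    addOrderOf (α : UnitAddCircle) = 0 := by
  refine addOrderOf_eq_zero_iff'.2 fun n hn h => ?_
  rw [← AddCircle.coe_nsmul, AddCircle.coe_eq_zero_iff] at h
  obtain ⟨m, hm⟩ := h
  have := (irrational_natCast_mul_iff.2 ⟨hn.ne', hα⟩).ne_int m
  simp at hm this
  exact this hm.symm

/-- Baire category: sets which are neighbourhoods of every torsion point of a period `q` with
`q * a ∉ ℤ` have a common point of infinite order. -/
theorem exists_addOrderOf_eq_zero_forall_mem {a : ℝ} (ha : ∀ m : ℤ, (m : ℝ) ≠ a)
    {V : ℕ → Set UnitAddCircle}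
    (hV : ∀ k (β : UnitAddCircle) (q : ℕ), 0 < q → q • β = 0 → (∀ m : ℤ, (m : ℝ) ≠ q * a) →
      V k ∈ 𝓝 β) :
    ∃ α : UnitAddCircle, addOrderOf α = 0 ∧ ∀ k, α ∈ V k := by
  have hcont : Continuous fun r : ℝ => (r : UnitAddCircle) := AddCircle.continuous_mk' (1 : ℝ)
  have hres : ∀ k, ∀ᶠ α : ℝ in residual ℝ, (α : UnitAddCircle) ∈ V k := by
    intro k
    have hd : Dense (interior {r : ℝ | (r : UnitAddCircle) ∈ V k}) := by
      refine (dense_setOf_div_mul_ne_intCast ha).mono ?_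
      rintro r ⟨q, p, hq, rfl, hqa⟩
      refine mem_interior_iff_mem_nhds.2 (hcont.continuousAt (hV k _ q hq ?_ hqa))
      rw [← AddCircle.coe_nsmul, AddCircle.coe_eq_zero_iff]
      refine ⟨p, ?_⟩
      have : (q : ℝ) ≠ 0 := by positivity
      simp only [zsmul_eq_mul, mul_one, nsmul_eq_mul]
      field_simp
    exact mem_of_superset (residual_of_dense_open isOpen_interior hd) interior_subset
  obtain ⟨α, hα, hαV⟩ := (dense_of_mem_residual
    (eventually_residual_irrational.and (eventually_countable_forall.2 hres))).nonempty
  exact ⟨α, addOrderOf_coe_eq_zero_of_irrational hα, hαV⟩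

/-- Some rotation of infinite order is so close to infinitely many periodic ones that its averages
inherit their deviation from `a` at times `N` at which `ψ N` is already far smaller. -/
theorem exists_slow_rotation {ψ : ℕ → ℝ} (hψ : Tendsto ψ atTop (𝓝[>] 0)) {A : Set UnitAddCircle}
    (hA : MeasurableSet A) {a : ℝ} (ha : ∀ m : ℤ, (m : ℝ) ≠ a) :
    ∃ α : UnitAddCircle, addOrderOf α = 0 ∧ ∀ᵐ x, ∀ k : ℕ, ∃ N ≥ k, 0 < ψ N ∧
      k * ψ N < |ergodicAverage (· + α) (A.indicator fun _ => (1 : ℝ)) N x - a| := by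
  have hpos : ∀ᶠ N in atTop, 0 < ψ N := hψ.eventually self_mem_nhdsWithin
  -- The rotations for which, at some late time `N`, the deviation exceeds `k * ψ N` outside a set of
  -- measure at most `1 / (k + 1)`.
  let V : ℕ → Set UnitAddCircle := fun k => {α | ∃ N ≥ k, 0 < ψ N ∧
    volume {x | |ergodicAverage (· + α) (A.indicator fun _ => (1 : ℝ)) N x - a| ≤ k * ψ N} ≤
      ((k : ENNReal) + 1)⁻¹}
  have hV : ∀ k (β : UnitAddCircle) (q : ℕ), 0 < q → q • β = 0 → (∀ m : ℤ, (m : ℝ) ≠ q * a) →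
      V k ∈ 𝓝 β := by
    intro k β q hq hβ hqa
    obtain ⟨δ, hδ, hβδ⟩ := exists_pos_forall_le_abs_ergodicAverage_sub A hq hβ hqa
    have hlim : Tendsto (fun N => k * ψ N) atTop (𝓝 0) := by
      simpa using (hψ.mono_right nhdsWithin_le_nhds).const_mul (k : ℝ)
    have hmul : Tendsto (fun M : ℕ => M * q) atTop atTop := tendsto_id.atTop_mul_const' hq
    obtain ⟨M, ⟨hMδ, hMpos⟩, hM⟩ := ((hmul.eventually
      ((hlim.eventually_lt_const hδ).and hpos)).and (eventually_gt_atTop k)).exists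
    have hε : (0 : ENNReal) < ((k : ENNReal) + 1)⁻¹ :=
      ENNReal.inv_pos.2 (by finiteness)
    filter_upwards [(tendsto_measure_ergodicAverage_ne hA (M * q) β).eventually_lt_const hε]
      with α hα
    refine ⟨M * q, hM.le.trans (Nat.le_mul_of_pos_right M hq), hMpos,
      (measure_mono fun x hx hne => ?_).trans hα.le⟩
    have hx' : |ergodicAverage (· + α) (A.indicator fun _ => (1 : ℝ)) (M * q) x - a| ≤
      k * ψ (M * q) := hx
    rw [hne] at hx'
    exact absurd (hβδ M (by omega) x) (not_le.2 (hx'.trans_lt hMδ))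
  obtain ⟨α, hα, hαV⟩ := exists_addOrderOf_eq_zero_forall_mem ha hV
  refine ⟨α, hα, ae_all_iff.2 fun k => ?_⟩
  rw [ae_iff]
  -- The exceptional set for `k` lies in the exceptional set for each `m ≥ k`, whose measure tends
  -- to `0`.
  have hle : ∀ m ≥ k, volume {x | ¬∃ N ≥ k, 0 < ψ N ∧ k * ψ N <
      |ergodicAverage (· + α) (A.indicator fun _ => (1 : ℝ)) N x - a|} ≤
      ((m : ENNReal) + 1)⁻¹ := by
    intro m hm
    obtain ⟨N, hN, hNpos, hvol⟩ := hαV m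
    refine (measure_mono fun x hx => ?_).trans hvol
    push Not at hx
    refine (hx N (hm.trans hN) hNpos).trans ?_
    have : (k : ℝ) ≤ m := Nat.cast_le.2 hm
    gcongr
  have hlim : Tendsto (fun m : ℕ => ((m : ENNReal) + 1)⁻¹) atTop (𝓝 0) := by
    have := (tendsto_add_atTop_iff_nat 1).2 ENNReal.tendsto_inv_nat_nhds_zero
    simpa using this
  exact le_antisymm (ge_of_tendsto hlim (eventually_atTop.2 ⟨k, hle⟩)) zero_le

/-! ### Existence of slowly converging averages -/

/-- The positivity of `ψ N` rules out the indices at which the quotient could be a junk value. -/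
theorem limsup_coe_div_eq_top {ψ u : ℕ → ℝ}
    (h : ∀ k : ℕ, ∃ N ≥ k, 0 < ψ N ∧ k * ψ N < u N) :
    limsup (fun N => ((u N / ψ N : ℝ) : EReal)) atTop = ⊤ := by
  refine EReal.eq_top_iff_forall_lt _ |>.2 fun c => ?_
  refine (EReal.coe_lt_coe_iff.2 (lt_add_one c)).trans_le (le_limsup_of_frequently_le ?_)
  refine frequently_atTop.2 fun n => ?_
  obtain ⟨k, hk⟩ := exists_nat_ge (max (n : ℝ) (c + 1))
  obtain ⟨N, hN, hpos, hlt⟩ := h k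
  refine ⟨N, (Nat.cast_le.1 ((le_max_left _ _).trans hk)).trans hN, ?_⟩
  rw [EReal.coe_le_coe_iff, le_div_iff₀ hpos]
  exact (mul_le_mul_of_nonneg_right ((le_max_right _ _).trans hk) hpos.le).trans hlt.le

theorem exists_measurableSet_unitAddCircle {a : ℝ} (h0 : 0 < a) (h1 : a < 1) :
    ∃ A : Set UnitAddCircle, MeasurableSet A ∧ volume.real A = a := by
  refine ⟨Metric.closedBall 0 (a / 2), Metric.isClosed_closedBall.measurableSet, ?_⟩
  rw [measureReal_def, AddCircle.volume_closedBall, mul_div_cancel₀ _ two_ne_zero,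
    min_eq_right h1.le, ENNReal.toReal_ofReal h0.le]

theorem mainTheorem1 {X : Type*} [MeasurableSpace X] [StandardBorelSpace X]
    (μ : MeasureTheory.Measure X) [MeasureTheory.IsProbabilityMeasure μ]
    [MeasureTheory.NullSingletonClass μ]
    (ψ : ℕ → ℝ) (hψ : Filter.Tendsto ψ Filter.atTop (nhdsWithin 0 (Set.Ioi 0)))
    (a : ℝ) (ha : a ∈ Set.Ioo (0 : ℝ) 1) :
    ∃ (A : Set X) (T : X ≃ᵐ X),
      MeasurableSet A ∧ μ.real A = a ∧ Ergodic T μ ∧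
      ∀ᵐ x ∂μ,
        Filter.limsup
          (fun N : ℕ =>
            ((|ergodicAverage T (A.indicator (fun _ => (1 : ℝ))) N x - μ.real A| / ψ N : ℝ) :
              EReal))
          Filter.atTop = ⊤ := by
  have ha_int : ∀ m : ℤ, (m : ℝ) ≠ a := by
    rintro m rfl
    have h0 : 0 < m := by exact_mod_cast ha.1
    have h1 : m < 1 := by exact_mod_cast ha.2
    omega
  obtain ⟨φ, s, hφ, hs, hμs, hinj⟩ := exists_measurePreserving_injOn_unitAddCircle μ
  obtain ⟨B, hB, hBa⟩ := exists_measurableSet_unitAddCircle ha.1 ha.2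
  obtain ⟨α, hα, hslow⟩ := exists_slow_rotation hψ hB ha_int
  obtain ⟨T, hT, hφT⟩ := exists_ergodic_semiconj_of_injOn hφ hs hμs hinj
    (MeasurableEquiv.addRight α) (AddCircle.ergodic_add_right.2 hα)
  have hA : μ.real (φ ⁻¹' B) = a := by
    rw [measureReal_def, hφ.measure_preimage hB.nullMeasurableSet, ← measureReal_def, hBa]
  refine ⟨φ ⁻¹' B, T, hφ.measurable hB, hA, hT, ?_⟩
  filter_upwards [hφT, hφ.quasiMeasurePreserving.ae hslow] with x hx hxslow
  rw [hA]
  refine limsup_coe_div_eq_top fun k => ?_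
  obtain ⟨N, hN, hpos, hlt⟩ := hxslow k
  refine ⟨N, hN, hpos, hlt.trans_eq ?_⟩
  have : ∀ i, (φ ⁻¹' B).indicator (fun _ => (1 : ℝ)) (T^[i] x) =
      B.indicator (fun _ => (1 : ℝ)) ((· + α)^[i] (φ x)) := fun i => by
    change B.indicator (fun _ => (1 : ℝ)) (φ (T^[i] x)) = _
    rw [hx i]
    rfl
  simp only [ergodicAverage, this]
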